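/- Let $\mathcal H_A$, $\mathcal H_E$ be finite-dimensional complex Hilbert spaces, with fixed ("computational") orthonormal basis $\{|i\rangle\}$ of $\mathcal H_A$. Write $\mathcal D(\mathcal H)$ for the density matrices on $\mathcal H$ and $\mathcal I\subseteq\mathcal D(\mathcal H_A)$ for those that are diagonal in the computational basis. For positive semidefinite $\rho,\sigma$ put $F(\rho,\sigma)=\big(\mathrm{Tr}\sqrt{\sqrt\rho\,\sigma\sqrt\rho}\big)^2$, $D_{\min}(\rho\|\sigma)=-\log_2F(\rho,\sigma)$ and $D_{\max}(\rho\|\sigma)=\log_2\min\{\lambda\in\mathbb R:\rho\le\lambda\sigma\}$ (with value $+\infty$ if $F(\rho,\sigma)=0$, respectively if no such $\lambda$ exists). Define $$C_{\max}(\rho)=\min_{\delta\in\mathcal I}D_{\max}(\rho\|\delta),\quad C_{\min}(\rho)=\min_{\delta\in\mathcal I}D_{\min}(\rho\|\delta),\quad C_g(\rho)=\min_{\delta\in\mathcal I}\big(1-F(\rho,\delta)\big),$$ and, for a state $\rho_{AB}$, $$H_{\min}(A|B)=\max\{\lambda\in\mathbb R:\exists\,\sigma_B\in\mathcal D(\mathcal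 H_B),\ \rho_{AB}\le2^{-\lambda}I_A\otimes\sigma_B\},\quad H_{\max}(A|B)=\max_{\sigma_B\in\mathcal D(\mathcal H_B)}\log_2F(I_A\otimes\sigma_B,\rho_{AB}).$$ Theorem. Let $\rho_A\in\mathcal D(\mathcal H_A)$, let $|\psi\rangle_{AE}\in\mathcal H_A\otimes\mathcal H_E$ be any purification of $\rho_A$, i.e. $\rho_A=\mathrm{Tr}_E|\psi\rangle\langle\psi|$, and let $$\rho_{X_AE}=\sum_i(|i\rangle\langle i|\otimes I_E)\,|\psi\rangle\langle\psi|\,(|i\rangle\langle i|\otimes I_E).$$ Then all the minima over $\mathcal I$ and the maxima above that define $C_{\max}(\rho_A)$, $C_{\min}(\rho_A)$, $C_g(\rho_A)$ and $H_{\min}(X_A|E)$, $H_{\max}(X_A|E)$ for the state $\rho_{X_AE}$ are attained, these five quantities are real numbers, and $$C_{\max}(\rho_A)=H_{\max}(X_A|E),\qquad C_{\min}(\rho_A)=H_{\min}(X_A|E),\qquad C_g(\rho_A)=1-2^{-H_{\min}(X_A|E)}.$$ -/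

import Mathlib

open scoped ComplexOrder MatrixOrder Kronecker

namespace CoherenceEntropy

noncomputable section

/-- Density matrices: `𝒟(ℋ)` for the Hilbert space with orthonormal (computational) basis
indexed by `A`. -/
def states (A : Type*) [Fintype A] : Set (Matrix A A ℂ) :=
  {ρ | ρ.PosSemidef ∧ ρ.trace = 1}

/-- Incoherent states: density matrices that are diagonal in the computational basis. -/
def incoherentStates (A : Type*) [Fintype A] : Set (Matrix A A ℂ) :=
  {δ | δ ∈ states A ∧ δ.IsDiag}

/-- `log₂ x` for `x ≥ 0`, with `log₂ 0 = -∞`. -/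
def log₂ (x : ℝ) : EReal :=
  if x = 0 then ⊥ else ((Real.logb 2 x : ℝ) : EReal)

section OneSystem

variable {A : Type*} [Fintype A] [DecidableEq A]

/-- The fidelity `F(ρ, σ) = (Tr √(√ρ σ √ρ))²` of positive semidefinite matrices. -/
def fidelity (ρ σ : Matrix A A ℂ) : ℝ :=
  (CFC.sqrt (CFC.sqrt ρ * σ * CFC.sqrt ρ)).trace.re ^ 2

/-- The max-divergence `D_max(ρ‖σ) = log₂ min {l | ρ ≤ l σ}`, which is `+∞` if there is no
such `l`. The order is the Loewner order. -/
def dMax (ρ σ : Matrix A A ℂ) : EReal :=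
  open Classical in
  if {l : ℝ | ρ ≤ l • σ}.Nonempty then log₂ (sInf {l : ℝ | ρ ≤ l • σ}) else ⊤

/-- The min-divergence `D_min(ρ‖σ) = -log₂ F(ρ, σ)`, which is `+∞` if `F(ρ, σ) = 0`. -/
def dMin (ρ σ : Matrix A A ℂ) : EReal :=
  -log₂ (fidelity ρ σ)

/-- The max-entropy of coherence `C_max(ρ)`. -/
def cMax (ρ : Matrix A A ℂ) : EReal :=
  sInf ((fun δ => dMax ρ δ) '' incoherentStates A)

/-- The min-entropy of coherence `C_min(ρ)`. -/
def cMin (ρ : Matrix A A ℂ) : EReal :=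
  sInf ((fun δ => dMin ρ δ) '' incoherentStates A)

/-- The geometric coherence `C_g(ρ)`. -/
def cGeom (ρ : Matrix A A ℂ) : ℝ :=
  sInf ((fun δ => 1 - fidelity ρ δ) '' incoherentStates A)

end OneSystem

section TwoSystems

variable {A B : Type*} [Fintype A] [DecidableEq A] [Fintype B] [DecidableEq B]

/-- The values over which `H_min(A|B)` is the maximum: those real `l` for which some state `σ`
of `B` has `ρ ≤ 2^(-l) (1 ⊗ σ)`. -/
def hMinSet (ρ : Matrix (A × B) (A × B) ℂ) : Set ℝ :=
  {l : ℝ | ∃ σ ∈ states B, ρ ≤ (2 : ℝ) ^ (-l) • ((1 : Matrix A A ℂ) ⊗ₖ σ)}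

/-- The conditional min-entropy `H_min(A|B)`. -/
def hMin (ρ : Matrix (A × B) (A × B) ℂ) : ℝ :=
  sSup (hMinSet ρ)

/-- The values over which `H_max(A|B)` is the maximum: `log₂ F(1 ⊗ σ, ρ)` for states `σ`
of `B`. -/
def hMaxSet (ρ : Matrix (A × B) (A × B) ℂ) : Set EReal :=
  (fun σ => log₂ (fidelity ((1 : Matrix A A ℂ) ⊗ₖ σ) ρ)) '' states B

/-- The conditional max-entropy `H_max(A|B)`. -/
def hMax (ρ : Matrix (A × B) (A × B) ℂ) : EReal :=
  sSup (hMaxSet ρ)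

/-- The rank-one matrix `|ψ⟩⟨ψ|`. -/
def ketBra (ψ : A × B → ℂ) : Matrix (A × B) (A × B) ℂ :=
  Matrix.vecMulVec ψ (star ψ)

/-- The partial trace over the second system. -/
def partialTrace (M : Matrix (A × B) (A × B) ℂ) : Matrix A A ℂ :=
  Matrix.of fun i j => ∑ b, M (i, b) (j, b)

/-- The dephasing of the first system in its computational basis:
`∑ i, (|i⟩⟨i| ⊗ 1) M (|i⟩⟨i| ⊗ 1)`. -/
def dephase (M : Matrix (A × B) (A × B) ℂ) : Matrix (A × B) (A × B) ℂ :=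
  ∑ i : A, (Matrix.single i i (1 : ℂ) ⊗ₖ (1 : Matrix B B ℂ)) * M *
    (Matrix.single i i (1 : ℂ) ⊗ₖ (1 : Matrix B B ℂ))

end TwoSystems

end

end CoherenceEntropy

open CoherenceEntropy

/-! Regard ψ as a matrix `M` with rows indexed by `A`, so that ρ = M Mᴴ. Then F(ρ, δ) = (Tr √(Mᴴ δ
M))² and F(1 ⊗ σ, ρ_XE) = (Tr √diag(M σᵀ Mᴴ))², both by `fidelity_eq_of_mul_conjTranspose`. So C_min
and H_max each maximise Tr √T over a linear image of a compact convex set of states.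

The dual problems minimise a trace. For C_min it is Tr S over S dominating the rank-one matrix of
every conjugated row of `M`, which up to a transpose is H_min (`dephase_ketBra_le_iff`). For H_max
it is Tr D over diagonal D ≥ M Mᴴ, which is C_max.

Weak duality is `sq_trace_sqrt_le`. For strong duality, an invertible root R of a maximiser
satisfies Tr(R⁻¹ Y) ≤ Tr R on the feasible set; Schur complements turn this into dual feasibility of
(Tr R) R, whose trace is the primal value (Tr R)². Since R may be singular, the condition is proved
for T + ε 1 and only the resulting Loewner inequality is passed to the limit
(`exists_tendsto_sqrt_optimal`). -/

namespace CoherenceEntropy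

open Matrix Filter Topology

/-! ### Traces of square roots, fidelity and weak duality -/

section Trace

variable {m n : Type*} [Fintype m] [DecidableEq m] [Fintype n] [DecidableEq n]

lemma trace_mul_re_nonneg {P Q : Matrix n n ℂ} (hP : P.PosSemidef) (hQ : Q.PosSemidef) :
    0 ≤ (P * Q).trace.re := by
  have hQ' : 0 ≤ Q := hQ.nonneg
  have h : (P * Q).trace = (CFC.sqrt Q * P * (CFC.sqrt Q)ᴴ).trace := by
    rw [(CFC.sqrt_nonneg Q).posSemidef.isHermitian.eq, trace_mul_comm (CFC.sqrt Q * P),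
      ← mul_assoc, CFC.sqrt_mul_sqrt_self Q, trace_mul_comm]
  rw [h]
  exact (Complex.nonneg_iff.mp (hP.mul_mul_conjTranspose_same _).trace_nonneg).1

lemma trace_mul_re_le {P Q R : Matrix n n ℂ} (hPQ : P ≤ Q) (hR : R.PosSemidef) :
    (P * R).trace.re ≤ (Q * R).trace.re := by
  have h := trace_mul_re_nonneg (le_iff.mp hPQ) hR
  rw [sub_mul, trace_sub, Complex.sub_re] at h
  linarith

lemma trace_re_mono {P Q : Matrix n n ℂ} (hPQ : P ≤ Q) : P.trace.re ≤ Q.trace.re := by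
  simpa using trace_mul_re_le hPQ (PosSemidef.one (n := n) (R := ℂ))

omit [DecidableEq n] in
lemma trace_re_nonneg {P : Matrix n n ℂ} (hP : P.PosSemidef) : 0 ≤ P.trace.re :=
  (Complex.nonneg_iff.mp hP.trace_nonneg).1

/-- The square root of a positive semidefinite matrix agrees with `a ↦ a * g(a)` for a polynomial
`g` interpolating `x ↦ 1 / √x` on a finite set containing the spectrum. -/
lemma sqrt_eq_mul_aeval {P : Matrix n n ℂ} (hP : P.PosSemidef) (s : Finset ℝ)
    (hs : spectrum ℝ P ⊆ s) :
    CFC.sqrt P = P * Polynomial.aeval P (Lagrange.interpolate s id fun x => (√x)⁻¹) := by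
  have hP0 : 0 ≤ P := hP.nonneg
  have hsa : IsSelfAdjoint P := hP.isHermitian
  rw [CFC.sqrt_eq_real_sqrt P, cfcₙ_eq_cfc, ← cfc_polynomial _ P]
  nth_rw 2 [← cfc_id' ℝ P]
  rw [← cfc_mul _ _ P]
  refine cfc_congr fun x hx => ?_
  have hx0 : 0 ≤ x := spectrum_nonneg_of_nonneg hP0 hx
  have := Lagrange.eval_interpolate_at_node (s := s) (v := id) (fun x => (√x)⁻¹)
    Function.injective_id.injOn (hs hx)
  simp only [id] at this
  rw [this]
  rcases eq_or_lt_of_le hx0 with h | h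
  · simp [← h]
  · have h2 : √x ≠ 0 := (Real.sqrt_pos.mpr h).ne'
    field_simp
    exact Real.sq_sqrt hx0

/-- `B` intertwines `C * B` with `B * C`, hence all their powers. With C = Bᴴ this compares the
functional calculi of the two Gram matrices. -/
lemma mul_aeval_conjTranspose_mul (B : Matrix m n ℂ) (C : Matrix n m ℂ) (g : Polynomial ℝ) :
    B * Polynomial.aeval (C * B) g = Polynomial.aeval (B * C) g * B := by
  induction g using Polynomial.induction_on' with
  | add p q hp hq => simp only [map_add, Matrix.mul_add, Matrix.add_mul, hp, hq]
  | monomial k a =>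
    have h : B * (C * B) ^ k = (B * C) ^ k * B := by
      induction k with
      | zero => simp
      | succ k ih => rw [pow_succ, ← Matrix.mul_assoc, ih, pow_succ]; simp only [Matrix.mul_assoc]
    simp only [Polynomial.aeval_monomial, Algebra.algebraMap_eq_smul_one, smul_mul_assoc, one_mul,
      Matrix.mul_smul, Matrix.smul_mul, h]

/-- `B Bᴴ` and `Bᴴ B` have square roots of the same trace, the trace norm of `B`. -/
lemma trace_sqrt_mul_conjTranspose (B : Matrix m n ℂ) :
    (CFC.sqrt (B * Bᴴ)).trace = (CFC.sqrt (Bᴴ * B)).trace := by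
  have h1 : (spectrum ℝ (B * Bᴴ)).Finite := Matrix.finite_real_spectrum
  have h2 : (spectrum ℝ (Bᴴ * B)).Finite := Matrix.finite_real_spectrum
  -- Interpolating on the union of both spectra makes one polynomial serve both roots.
  rw [sqrt_eq_mul_aeval (posSemidef_self_mul_conjTranspose B) (h1.toFinset ∪ h2.toFinset)
      (by simp), sqrt_eq_mul_aeval (posSemidef_conjTranspose_mul_self B)
      (h1.toFinset ∪ h2.toFinset) (by simp)]
  rw [Matrix.mul_assoc B, trace_mul_comm B, Matrix.mul_assoc, ← mul_aeval_conjTranspose_mul,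
    ← Matrix.mul_assoc]

/-- √σ N Nᴴ √σ and Nᴴ σ N are the two Gram matrices of √σ N. As `N` may be rectangular, any
purification can replace the square root of the second argument. -/
lemma fidelity_eq_of_mul_conjTranspose {σ : Matrix m m ℂ} (hσ : σ.PosSemidef)
    (N : Matrix m n ℂ) :
    fidelity σ (N * Nᴴ) = (CFC.sqrt (Nᴴ * σ * N)).trace.re ^ 2 := by
  have hσ' : 0 ≤ σ := hσ.nonneg
  have hs : (CFC.sqrt σ)ᴴ = CFC.sqrt σ := (CFC.sqrt_nonneg σ).posSemidef.isHermitian.eq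
  have h := trace_sqrt_mul_conjTranspose (CFC.sqrt σ * N)
  rw [conjTranspose_mul, hs] at h
  rw [fidelity, Matrix.mul_assoc Nᴴ, ← CFC.sqrt_mul_sqrt_self σ]
  simp only [← Matrix.mul_assoc] at h ⊢
  rw [CFC.sqrt_mul_sqrt_self σ, h]

lemma fidelity_comm {ρ σ : Matrix m m ℂ} (hρ : ρ.PosSemidef) (hσ : σ.PosSemidef) :
    fidelity ρ σ = fidelity σ ρ := by
  have hσ' : 0 ≤ σ := hσ.nonneg
  have hs : (CFC.sqrt σ)ᴴ = CFC.sqrt σ := (CFC.sqrt_nonneg σ).posSemidef.isHermitian.eq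
  have h := fidelity_eq_of_mul_conjTranspose hρ (CFC.sqrt σ)
  rwa [hs, CFC.sqrt_mul_sqrt_self σ] at h

omit [Fintype n] in
lemma posDef_add_smul_one {P : Matrix n n ℂ} (hP : P.PosSemidef) {ε : ℝ} (hε : 0 < ε) :
    (P + ε • (1 : Matrix n n ℂ)).PosDef :=
  PosDef.posSemidef_add hP (PosDef.one.smul hε)

lemma continuousOn_sqrt : ContinuousOn (CFC.sqrt : Matrix n n ℂ → _) {P | P.PosSemidef} := by
  open scoped Matrix.Norms.L2Operator in
  have h := ContinuousOn.cfc_nnreal_of_mem_nhdsSet (X := Matrix n n ℂ) (A := Matrix n n ℂ)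
    NNReal.sqrt (a := id) (t := {P | P.PosSemidef}) (s := Set.univ) (by simp)
    continuousOn_id (fun P hP => hP.nonneg) NNReal.continuous_sqrt.continuousOn
  exact h.congr fun P _ => CFC.sqrt_eq_cfc

lemma isUnit_of_posDef {X : Matrix n n ℂ} (hX : X.PosDef) : IsUnit X.det :=
  (isUnit_iff_isUnit_det X).mp hX.isUnit

/-- The variational upper bound on the trace of a square root. -/
lemma two_mul_trace_sqrt_le {T X : Matrix n n ℂ} (hT : T.PosSemidef) (hX : X.PosDef) :
    2 * (CFC.sqrt T).trace.re ≤ X.trace.re + (X⁻¹ * T).trace.re := by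
  have hT' : 0 ≤ T := hT.nonneg
  have hs := (CFC.sqrt_nonneg T).posSemidef
  have hd : (CFC.sqrt T - X)ᴴ = CFC.sqrt T - X := by
    rw [conjTranspose_sub, hs.isHermitian.eq, hX.isHermitian.eq]
  -- The bound is Tr X⁻¹(√T − X)² ≥ 0, expanded.
  have h := trace_mul_re_nonneg hX.inv.posSemidef (posSemidef_self_mul_conjTranspose
    (CFC.sqrt T - X))
  have hu := isUnit_of_posDef hX
  have e : X⁻¹ * ((CFC.sqrt T - X) * (CFC.sqrt T - X)) =
      X⁻¹ * T - X⁻¹ * (CFC.sqrt T * X) - CFC.sqrt T + X := by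
    rw [mul_sub, sub_mul, sub_mul, CFC.sqrt_mul_sqrt_self T, mul_sub, mul_sub, mul_sub,
      nonsing_inv_mul_cancel_left _ _ hu, nonsing_inv_mul_cancel_left _ _ hu]
    abel
  have e2 : (X⁻¹ * (CFC.sqrt T * X)).trace = (CFC.sqrt T).trace := by
    rw [trace_mul_comm, mul_nonsing_inv_cancel_right _ _ hu]
  rw [hd, e, trace_add, trace_sub, trace_sub, e2] at h
  simp only [Complex.add_re, Complex.sub_re] at h
  linarith

/-- Weak duality for the trace of a square root. -/
lemma sq_trace_sqrt_le {T S : Matrix n n ℂ} (hT : T.PosSemidef) (hS : S.PosSemidef)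
    (h : ∀ η : ℝ, 0 < η → ((S + η • (1 : Matrix n n ℂ))⁻¹ * T).trace.re ≤ 1) :
    (CFC.sqrt T).trace.re ^ 2 ≤ S.trace.re := by
  set t := (CFC.sqrt T).trace.re
  have hS0 := trace_re_nonneg hS
  -- The cardinality is the trace of the identity; the extra 1 keeps `u` positive even when `n` is
  -- empty.
  have key : ∀ η : ℝ, 0 < η → t ^ 2 ≤ S.trace.re + η * (Fintype.card n + 1) := by
    intro η hη
    have hX := posDef_add_smul_one hS hη
    set X := S + η • (1 : Matrix n n ℂ)
    have htr : X.trace.re = S.trace.re + η * Fintype.card n := by simp [X]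
    have hc : (0 : ℝ) ≤ Fintype.card n := by positivity
    set u := S.trace.re + η * (Fintype.card n + 1)
    have hu : 0 < u := by positivity
    -- Testing with X / √u balances the two terms: each is at most √u.
    have hb := two_mul_trace_sqrt_le hT (hX.smul (inv_pos.mpr (Real.sqrt_pos.mpr hu)))
    have hinv : ((√u)⁻¹ • X)⁻¹ = √u • X⁻¹ := by
      have hne : √u ≠ 0 := (Real.sqrt_pos.mpr hu).ne'
      refine inv_eq_right_inv ?_
      rw [smul_mul_smul_comm, mul_nonsing_inv _ (isUnit_of_posDef hX), inv_mul_cancel₀ hne,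
        one_smul]
    rw [hinv, smul_mul_assoc, trace_smul, trace_smul, Complex.smul_re, Complex.smul_re] at hb
    simp only [smul_eq_mul] at hb
    have h1 : (√u)⁻¹ * X.trace.re ≤ (√u)⁻¹ * u := by
      gcongr
      rw [htr]; simp only [u]; nlinarith
    have h2 : (√u)⁻¹ * u = √u := by
      rw [inv_mul_eq_div, Real.div_sqrt]
    have h3 : √u * (X⁻¹ * T).trace.re ≤ √u * 1 := by
      gcongr
      exact h η hη
    have ht0 : 0 ≤ t := trace_re_nonneg (CFC.sqrt_nonneg T).posSemidef
    have ht : t ≤ √u := by linarith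
    calc t ^ 2 ≤ √u ^ 2 := by gcongr
      _ = u := Real.sq_sqrt hu.le
  refine le_of_forall_pos_le_add fun δ hδ => ?_
  have hc : (0 : ℝ) < Fintype.card n + 1 := by positivity
  have := key (δ / (Fintype.card n + 1)) (by positivity)
  rwa [div_mul_cancel₀ _ hc.ne'] at this

/-- Both sides say that the block matrix `[[R, B], [Bᴴ, s]]` is positive semidefinite. -/
lemma mul_conjTranspose_le_smul_iff {R : Matrix n n ℂ} (hR : R.PosDef) {s : ℝ} (hs : 0 < s)
    (B : Matrix n m ℂ) :
    B * Bᴴ ≤ s • R ↔ Bᴴ * R⁻¹ * B ≤ s • (1 : Matrix m m ℂ) := by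
  have hD : (s • (1 : Matrix m m ℂ)).PosDef := PosDef.one.smul hs
  let := hR.isUnit.invertible
  let := hD.isUnit.invertible
  have hinv : (s • (1 : Matrix m m ℂ))⁻¹ = s⁻¹ • 1 := by
    refine inv_eq_right_inv ?_
    rw [smul_mul_smul_comm, mul_one, mul_inv_cancel₀ hs.ne', one_smul]
  have h := (PosDef.fromBlocks₁₁ B (s • (1 : Matrix m m ℂ)) hR).symm.trans
    (PosDef.fromBlocks₂₂ R B hD)
  rw [le_iff, le_iff, h, hinv, Matrix.mul_smul, Matrix.smul_mul, Matrix.mul_one]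
  have e : s • R - B * Bᴴ = s • (R - s⁻¹ • (B * Bᴴ)) := by
    rw [smul_sub, smul_smul, mul_inv_cancel₀ hs.ne', one_smul]
  have e' : R - s⁻¹ • (B * Bᴴ) = s⁻¹ • (s • R - B * Bᴴ) := by
    rw [e, smul_smul, inv_mul_cancel₀ hs.ne', one_smul]
  constructor
  · intro h; rw [e']; exact h.smul (inv_pos.mpr hs).le
  · intro h; rw [e]; exact h.smul hs.le

end Trace

/-! ### First-order optimality for the trace of the square root -/

section Optimum

variable {n : Type*} [Fintype n] [DecidableEq n]

lemma posDef_sqrt {P : Matrix n n ℂ} (hP : P.PosDef) : (CFC.sqrt P).PosDef := by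
  have h0 : 0 ≤ P := hP.posSemidef.nonneg
  refine ((CFC.sqrt_nonneg P).posSemidef.posDef_iff_isUnit).mpr ?_
  rw [CFC.isUnit_sqrt_iff P]
  exact hP.isUnit

/-- First-order optimality for the maximum of the trace of a regularised square root over a compact
convex set of positive semidefinite matrices. -/
lemma exists_sqrt_add_smul_one_optimal {K : Set (Matrix n n ℂ)} (hc : IsCompact K)
    (hconv : Convex ℝ K) (hne : K.Nonempty) (hK : ∀ T ∈ K, T.PosSemidef) {ε : ℝ} (hε : 0 < ε) :
    ∃ T ∈ K, ∀ Y ∈ K, ((CFC.sqrt (T + ε • (1 : Matrix n n ℂ)))⁻¹ * Y).trace.re ≤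
      (CFC.sqrt (T + ε • (1 : Matrix n n ℂ))).trace.re := by
  set J : Matrix n n ℂ := ε • (1 : Matrix n n ℂ) with hJ
  have hpd : ∀ T ∈ K, (T + J).PosDef := fun T hT => posDef_add_smul_one (hK T hT) hε
  have hcs : ContinuousOn (fun T : Matrix n n ℂ => CFC.sqrt (T + J)) K :=
    continuousOn_sqrt.comp (continuous_id.add continuous_const).continuousOn
      fun T hT => (hpd T hT).posSemidef
  obtain ⟨T, hT, hmax⟩ := hc.exists_isMaxOn hne
    (f := fun T : Matrix n n ℂ => (CFC.sqrt (T + J)).trace.re)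
    (Complex.continuous_re.comp_continuousOn
      ((continuous_id.matrix_trace (n := n) (R := ℂ)).comp_continuousOn hcs))
  refine ⟨T, hT, fun Y hY => ?_⟩
  have hsq : ∀ Z ∈ K, (CFC.sqrt (Z + J)).PosDef := fun Z hZ => posDef_sqrt (hpd Z hZ)
  have hmulsq : ∀ Z ∈ K, (CFC.sqrt (Z + J))⁻¹ * (Z + J) = CFC.sqrt (Z + J) := fun Z hZ => by
    have h0 : 0 ≤ Z + J := (hpd Z hZ).posSemidef.nonneg
    nth_rw 2 [← CFC.sqrt_mul_sqrt_self (Z + J)]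
    rw [nonsing_inv_mul_cancel_left _ _ (isUnit_of_posDef (hsq Z hZ))]
  set Z : ℝ → Matrix n n ℂ := fun t => T + t • (Y - T) with hZ
  have hZK : ∀ t ∈ Set.Icc (0 : ℝ) 1, Z t ∈ K := fun t ht =>
    hconv.add_smul_sub_mem hT hY ht
  -- This avoids differentiating the square root: the variational bound for T + J, tested with the
  -- root at `Z t`, combines with maximality of `T` to give the sign for each t > 0, and then t → 0.
  have hslope : ∀ t ∈ Set.Ioc (0 : ℝ) 1,
      ((CFC.sqrt (Z t + J))⁻¹ * (Y - T)).trace.re ≤ 0 := by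
    intro t ht
    have hZt := hZK t ⟨ht.1.le, ht.2⟩
    have h1 := two_mul_trace_sqrt_le (hpd T hT).posSemidef (hsq _ hZt)
    have h2 : (CFC.sqrt (Z t + J)).trace.re ≤ (CFC.sqrt (T + J)).trace.re := hmax hZt
    have e : T + J = (Z t + J) - t • (Y - T) := by simp only [hZ]; abel
    have h3 : ((CFC.sqrt (Z t + J))⁻¹ * (T + J)).trace.re = (CFC.sqrt (Z t + J)).trace.re -
        t * ((CFC.sqrt (Z t + J))⁻¹ * (Y - T)).trace.re := by
      conv_lhs => rw [e, mul_sub, hmulsq _ hZt, mul_smul_comm, trace_sub, trace_smul]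
      simp
    rw [h3] at h1
    have : t * ((CFC.sqrt (Z t + J))⁻¹ * (Y - T)).trace.re ≤ 0 := by linarith
    by_contra hcon
    push Not at hcon
    linarith [mul_pos ht.1 hcon]
  have hlim : Tendsto (fun t : ℝ => ((CFC.sqrt (Z t + J))⁻¹ * (Y - T)).trace.re) (𝓝[>] 0)
      (𝓝 ((CFC.sqrt (T + J))⁻¹ * (Y - T)).trace.re) := by
    have hZc : Tendsto Z (𝓝[>] 0) (𝓝[K] T) := by
      refine tendsto_nhdsWithin_iff.mpr ⟨?_, ?_⟩
      · have : Continuous Z := by fun_prop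
        have h := this.tendsto 0
        simp only [hZ, zero_smul, add_zero] at h
        exact h.mono_left nhdsWithin_le_nhds
      · filter_upwards [Ioc_mem_nhdsGT (zero_lt_one (α := ℝ))] with t ht
        exact hZK t ⟨ht.1.le, ht.2⟩
    have h1 : Tendsto (fun t => CFC.sqrt (Z t + J)) (𝓝[>] 0) (𝓝 (CFC.sqrt (T + J))) :=
      (hcs T hT).tendsto.comp hZc
    have hdet : IsUnit (CFC.sqrt (T + J)).det := isUnit_of_posDef (hsq T hT)
    have h2 := (continuousAt_matrix_inv (CFC.sqrt (T + J)) (by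
      rw [Ring.inverse_eq_inv']
      exact continuousAt_inv₀ hdet.ne_zero)).tendsto.comp h1
    have h3 : Continuous fun W : Matrix n n ℂ => (W * (Y - T)).trace.re :=
      Complex.continuous_re.comp (continuous_id.matrix_mul continuous_const).matrix_trace
    exact (h3.tendsto _).comp h2
  have h0 : ((CFC.sqrt (T + J))⁻¹ * (Y - T)).trace.re ≤ 0 :=
    le_of_tendsto hlim (by
      filter_upwards [Ioc_mem_nhdsGT (zero_lt_one (α := ℝ))] with t ht using hslope t ht)
  -- With R the root of T + J, Tr R⁻¹(T + J) = Tr R, and dropping `J` only lowers the left side.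
  have h4 : ((CFC.sqrt (T + J))⁻¹ * T).trace.re ≤ (CFC.sqrt (T + J)).trace.re := by
    nth_rw 2 [← hmulsq T hT]
    rw [Matrix.mul_add, trace_add, Complex.add_re]
    have := trace_mul_re_nonneg (hsq T hT).inv.posSemidef
      ((PosDef.one (n := n) (R := ℂ)).smul hε).posSemidef
    linarith
  rw [mul_sub, trace_sub, Complex.sub_re] at h0
  linarith

/-- An element of a compact convex set of positive semidefinite matrices whose square root is a
limit of positive definite matrices that satisfy the first-order condition for a maximum of the
trace of the square root. -/
lemma exists_tendsto_sqrt_optimal {K : Set (Matrix n n ℂ)} (hc : IsCompact K)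
    (hconv : Convex ℝ K) (hne : K.Nonempty) (hK : ∀ T ∈ K, T.PosSemidef) :
    ∃ T ∈ K, ∃ P : ℕ → Matrix n n ℂ, (∀ k, (P k).PosDef) ∧
      (∀ k, ∃ T' ∈ K, ∃ ε : ℝ, P k = T' + ε • (1 : Matrix n n ℂ)) ∧
      Tendsto (fun k => CFC.sqrt (P k)) atTop (𝓝 (CFC.sqrt T)) ∧
      ∀ k, ∀ Y ∈ K, ((CFC.sqrt (P k))⁻¹ * Y).trace.re ≤ (CFC.sqrt (P k)).trace.re := by
  choose! T hT hopt using fun k : ℕ =>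
    exists_sqrt_add_smul_one_optimal hc hconv hne hK (Nat.one_div_pos_of_nat (n := k) (α := ℝ))
  have : FirstCountableTopology (Matrix n n ℂ) :=
    inferInstanceAs (FirstCountableTopology (n → n → ℂ))
  obtain ⟨T₀, hT₀, φ, hφ, hlim⟩ := hc.tendsto_subseq hT
  have hpd : ∀ k : ℕ, (T (φ k) + (1 / ((φ k : ℕ) + 1 : ℝ)) • (1 : Matrix n n ℂ)).PosDef :=
    fun k => posDef_add_smul_one (hK _ (hT _)) Nat.one_div_pos_of_nat
  refine ⟨T₀, hT₀, fun k => T (φ k) + (1 / ((φ k : ℕ) + 1 : ℝ)) • (1 : Matrix n n ℂ), hpd,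
    fun k => ⟨_, hT _, _, rfl⟩, ?_, fun k => hopt (φ k)⟩
  have h1 : Tendsto (fun k => T (φ k) + (1 / ((φ k : ℕ) + 1 : ℝ)) • (1 : Matrix n n ℂ)) atTop
      (𝓝 T₀) := by
    have := ((tendsto_one_div_add_atTop_nhds_zero_nat (𝕜 := ℝ)).comp hφ.tendsto_atTop).smul_const
      (1 : Matrix n n ℂ)
    simpa using hlim.add this
  exact (continuousOn_sqrt T₀ (hK _ hT₀)).tendsto.comp
    (tendsto_nhdsWithin_iff.mpr ⟨h1, Eventually.of_forall fun k => (hpd k).posSemidef⟩)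

lemma le_of_tendsto_matrix {P : Matrix n n ℂ} {Q : ℕ → Matrix n n ℂ} {Q₀ : Matrix n n ℂ}
    (h : Tendsto Q atTop (𝓝 Q₀)) (hle : ∀ k, P ≤ Q k) : P ≤ Q₀ := by
  open scoped Matrix.Norms.L2Operator in
  exact ge_of_tendsto' h hle

lemma isDiag_sqrt {P : Matrix n n ℂ} (hP : P.PosSemidef) (hd : P.IsDiag) :
    (CFC.sqrt P).IsDiag := by
  have h0 : ∀ i, 0 ≤ P i i := fun i => hP.diag_nonneg
  have hQ : (diagonal fun i => ((√(P i i).re : ℝ) : ℂ)).PosSemidef :=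
    PosSemidef.diagonal fun i => by simp [Real.sqrt_nonneg]
  have hQ0 := hQ.nonneg
  have : CFC.sqrt P = diagonal fun i => ((√(P i i).re : ℝ) : ℂ) := by
    refine CFC.sqrt_unique ?_
    conv_rhs => rw [← hd.diagonal_diag]
    rw [diagonal_mul_diagonal]
    congr 1
    funext i
    obtain ⟨hre, him⟩ := Complex.nonneg_iff.mp (h0 i)
    rw [← Complex.ofReal_mul, Real.mul_self_sqrt hre]
    exact Complex.ext (by simp) (by simpa using him)
  rw [this]
  exact isDiag_diagonal _

end Optimum

/-! ### Convexity and compactness of the sets of states -/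

section States

variable {n : Type*} [Fintype n]

lemma convex_states : Convex ℝ (states n) := by
  intro x hx y hy a b ha hb hab
  refine ⟨(hx.1.smul ha).add (hy.1.smul hb), ?_⟩
  rw [trace_add, trace_smul, trace_smul, hx.2, hy.2, ← add_smul, hab, one_smul]

lemma convex_incoherentStates : Convex ℝ (incoherentStates n) := by
  intro x hx y hy a b ha hb hab
  exact ⟨convex_states hx.1 hy.1 ha hb hab, (hx.2.smul a).add (hy.2.smul b)⟩

lemma single_mem_incoherentStates [DecidableEq n] (i : n) :
    single i i (1 : ℂ) ∈ incoherentStates n := by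
  rw [← diagonal_single]
  refine ⟨⟨PosSemidef.diagonal (Pi.single_nonneg.mpr zero_le_one), by simp⟩, isDiag_diagonal _⟩

/-- The states are the image of the Hilbert–Schmidt unit sphere under s ↦ s sᴴ; entries on that
sphere have modulus at most 1. -/
lemma isCompact_states [DecidableEq n] : IsCompact (states n) := by
  have hS : IsCompact {s : Matrix n n ℂ | (s * sᴴ).trace = 1} := by
    refine ((isCompact_closedBall (0 : ℂ) 1).matrix (m := n) (n := n)).of_isClosed_subset
      (isClosed_eq (by fun_prop) continuous_const) fun s hs i j => ?_
    rw [mem_closedBall_zero_iff]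
    have h : ∑ i, ∑ j, ‖s i j‖ ^ 2 = 1 := by
      have := congrArg Complex.re hs
      simpa [trace, Matrix.mul_apply, Complex.mul_conj, Complex.normSq_eq_norm_sq,
        ← Complex.ofReal_pow] using this
    have h1 : ‖s i j‖ ^ 2 ≤ 1 := by
      rw [← h]
      refine le_trans ?_ (Finset.single_le_sum (f := fun i => ∑ j, ‖s i j‖ ^ 2)
        (fun _ _ => by positivity) (Finset.mem_univ i))
      exact Finset.single_le_sum (f := fun j => ‖s i j‖ ^ 2)
        (fun _ _ => by positivity) (Finset.mem_univ j)
    exact (sq_le_one_iff₀ (norm_nonneg _)).mp h1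
  have : states n = (fun s : Matrix n n ℂ => s * sᴴ) '' {s | (s * sᴴ).trace = 1} := by
    ext ρ
    constructor
    · rintro ⟨h, htr⟩
      have h0 : 0 ≤ ρ := h.nonneg
      have e : CFC.sqrt ρ * (CFC.sqrt ρ)ᴴ = ρ := by
        rw [(CFC.sqrt_nonneg ρ).posSemidef.isHermitian.eq, CFC.sqrt_mul_sqrt_self ρ]
      exact ⟨CFC.sqrt ρ, by rw [Set.mem_ofPred_eq, e, htr], e⟩
    · rintro ⟨s, hs, rfl⟩
      exact ⟨posSemidef_self_mul_conjTranspose s, hs⟩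
  rw [this]
  exact hS.image (by fun_prop)

lemma isCompact_incoherentStates [DecidableEq n] : IsCompact (incoherentStates n) := by
  refine isCompact_states.inter_right ?_
  have : {δ : Matrix n n ℂ | δ.IsDiag} = {δ | diagonal δ.diag = δ} := by
    ext δ; exact isDiag_iff_diagonal_diag δ
  change IsClosed {δ : Matrix n n ℂ | δ.IsDiag}
  rw [this]
  exact isClosed_eq (by fun_prop) continuous_id

end States

/-! ### Weak and strong duality for the two optimisation problems -/

section Duality

variable {A E : Type*} [Fintype A] [DecidableEq A] [Fintype E] [DecidableEq E]

omit [DecidableEq E] in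
lemma trace_re_pos_of_posDef [Nonempty E] {X : Matrix E E ℂ} (hX : X.PosDef) : 0 < X.trace.re :=
  (Complex.pos_iff.mp hX.trace_pos).1

/-- The Schur complement equivalence for a single column, where one side becomes scalar. -/
lemma vecMulVec_star_le_smul_iff {X : Matrix E E ℂ} (hX : X.PosDef) {s : ℝ} (hs : 0 < s)
    (v : E → ℂ) :
    vecMulVec v (star v) ≤ s • X ↔ (star v ⬝ᵥ X⁻¹ *ᵥ v).re ≤ s := by
  have h := mul_conjTranspose_le_smul_iff hX hs (replicateCol Unit v)
  have e : replicateCol Unit v * (replicateCol Unit v)ᴴ = vecMulVec v (star v) := by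
    ext i j; simp [Matrix.mul_apply, vecMulVec_apply]
  have e' : (replicateCol Unit v)ᴴ * X⁻¹ * replicateCol Unit v =
      diagonal fun _ => star v ⬝ᵥ X⁻¹ *ᵥ v := by
    ext i j
    rw [Matrix.mul_assoc]
    simp [Matrix.mul_apply, dotProduct, mulVec]
  have e'' : s • (1 : Matrix Unit Unit ℂ) = diagonal fun _ => (s : ℂ) := by
    ext i j; simp
  rw [e, e', e''] at h
  rw [h, le_iff, diagonal_sub, posSemidef_diagonal_iff]
  have him : (star v ⬝ᵥ X⁻¹ *ᵥ v).im = 0 := by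
    have := hX.inv.posSemidef.dotProduct_mulVec_nonneg v
    exact (Complex.nonneg_iff.mp this).2.symm
  constructor
  · intro h
    have := (Complex.nonneg_iff.mp (h ())).1
    rw [Complex.sub_re, Complex.ofReal_re] at this
    linarith
  · intro h _
    rw [Complex.nonneg_iff, Complex.sub_re, Complex.sub_im, Complex.ofReal_re, Complex.ofReal_im,
      him]
    exact ⟨by linarith, by simp⟩

/-- Normalised rank-one states recover the quadratic form. This turns the first-order condition over
all states into a Loewner inequality. -/
lemma le_smul_one_of_trace_mul_le [Nonempty E] {H : Matrix E E ℂ} (hH : H.IsHermitian) {s : ℝ}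
    (h : ∀ τ ∈ states E, (H * τ).trace.re ≤ s) : H ≤ s • (1 : Matrix E E ℂ) := by
  have hD : (s • (1 : Matrix E E ℂ) - H).IsHermitian :=
    (isHermitian_one.smul (IsSelfAdjoint.all s)).sub hH
  refine le_iff.mpr (PosSemidef.of_dotProduct_mulVec_nonneg hD fun x => ?_)
  by_cases hx : x = 0
  · simp [hx]
  have hpos : 0 < (star x ⬝ᵥ x) := dotProduct_star_self_pos_iff.mpr hx
  obtain ⟨hre, him⟩ := Complex.pos_iff.mp hpos
  set c := (star x ⬝ᵥ x).re with hc
  have hcx : star x ⬝ᵥ x = (c : ℂ) := Complex.ext (by simp [hc]) (by simp [← him])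
  have hτ : c⁻¹ • vecMulVec x (star x) ∈ states E := by
    refine ⟨(posSemidef_vecMulVec_self_star x).smul (inv_nonneg.mpr hre.le), ?_⟩
    rw [trace_smul, trace_vecMulVec, dotProduct_comm, hcx, Complex.real_smul, ← Complex.ofReal_mul,
      inv_mul_cancel₀ hre.ne', Complex.ofReal_one]
  have hle := h _ hτ
  rw [mul_smul_comm, trace_smul, mul_vecMulVec, trace_vecMulVec, dotProduct_comm, Complex.smul_re,
    smul_eq_mul, inv_mul_le_iff₀ hre] at hle
  have him' : (star x ⬝ᵥ H *ᵥ x).im = 0 := by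
    simpa using hH.im_star_dotProduct_mulVec_self x
  rw [sub_mulVec, smul_mulVec, one_mulVec, dotProduct_sub, dotProduct_smul, hcx,
    Complex.nonneg_iff, Complex.sub_re, Complex.sub_im, him']
  refine ⟨?_, by simp⟩
  simp only [Complex.smul_re, Complex.ofReal_re, smul_eq_mul]
  linarith

/-- Weak duality: the squared trace norm of `√δ M` is at most the trace of any common upper bound
of the rank-one matrices of the (conjugated) rows of `M`. -/
lemma sq_trace_sqrt_conjugate_le (M : Matrix A E ℂ) {δ : Matrix A A ℂ}
    (hδ : δ ∈ incoherentStates A) {S : Matrix E E ℂ} (hS : S.PosSemidef)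
    (h : ∀ i, vecMulVec (star (M i)) (M i) ≤ S) :
    (CFC.sqrt (Mᴴ * δ * M)).trace.re ^ 2 ≤ S.trace.re := by
  refine sq_trace_sqrt_le (hδ.1.1.conjTranspose_mul_mul_same M) hS fun η hη => ?_
  have hX := posDef_add_smul_one hS hη
  set X := S + η • (1 : Matrix E E ℂ)
  have hSX : S ≤ X := by
    rw [le_iff, add_sub_cancel_left]
    exact (PosDef.one.smul hη).posSemidef
  -- The trace to be bounded is the average of these diagonal entries with weights δ i i, because δ
  -- is diagonal.
  have hq : ∀ i, ((M * X⁻¹ * Mᴴ) i i).re ≤ 1 := fun i => by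
    have h1 : vecMulVec (star (M i)) (star (star (M i))) ≤ (1 : ℝ) • X := by
      rw [star_star, one_smul]; exact (h i).trans hSX
    have h2 := (vecMulVec_star_le_smul_iff hX one_pos _).mp h1
    rw [star_star] at h2
    rw [Matrix.mul_assoc]
    convert h2 using 2
    simp [Matrix.mul_apply, dotProduct, mulVec]
  have e : (X⁻¹ * (Mᴴ * δ * M)).trace = (M * X⁻¹ * Mᴴ * δ).trace := by
    rw [← Matrix.mul_assoc, trace_mul_comm]
    simp only [Matrix.mul_assoc]
  have htr : ∑ i, (δ i i).re = 1 := by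
    have := congrArg Complex.re hδ.1.2
    simpa [trace] using this
  have hδ0 : ∀ i, 0 ≤ (δ i i).re ∧ 0 = (δ i i).im := fun i =>
    Complex.nonneg_iff.mp hδ.1.1.diag_nonneg
  rw [e, ← hδ.2.diagonal_diag]
  simp only [trace, diag_apply, mul_diagonal, Complex.re_sum, Complex.mul_re, ← (hδ0 _).2, mul_zero,
    sub_zero]
  rw [← htr]
  exact Finset.sum_le_sum fun i _ => mul_le_of_le_one_left (hδ0 i).1 (hq i)

/-- Strong duality for the trace norm of `√δ M`, maximised over incoherent states `δ`. -/
lemma exists_incoherent_trace_sqrt_eq [Nonempty A] [Nonempty E] (M : Matrix A E ℂ) :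
    ∃ δ ∈ incoherentStates A, ∃ S : Matrix E E ℂ, S.PosSemidef ∧
      (∀ i, vecMulVec (star (M i)) (M i) ≤ S) ∧
      S.trace.re = (CFC.sqrt (Mᴴ * δ * M)).trace.re ^ 2 := by
  have hcont : Continuous fun δ : Matrix A A ℂ => Mᴴ * δ * M := by fun_prop
  have hlin : IsLinearMap ℝ fun δ : Matrix A A ℂ => Mᴴ * δ * M :=
    ⟨fun x y => by rw [Matrix.mul_add, Matrix.add_mul],
      fun c x => by rw [Matrix.mul_smul, Matrix.smul_mul]⟩
  obtain ⟨i₀⟩ := ‹Nonempty A›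
  obtain ⟨T, ⟨δ, hδ, rfl⟩, P, hP, -, hlim, hopt⟩ := exists_tendsto_sqrt_optimal
    (isCompact_incoherentStates.image hcont) (convex_incoherentStates.is_linear_image hlin)
    ⟨_, _, single_mem_incoherentStates i₀, rfl⟩
    (by rintro _ ⟨δ, hδ, rfl⟩; exact hδ.1.1.conjTranspose_mul_mul_same M)
  have hR := (CFC.sqrt_nonneg (Mᴴ * δ * M)).posSemidef
  -- The dual optimum is (Tr R) R with R the root of the optimal matrix.
  refine ⟨δ, hδ, (CFC.sqrt (Mᴴ * δ * M)).trace.re • CFC.sqrt (Mᴴ * δ * M),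
    hR.smul (trace_re_nonneg hR), fun i => ?_, ?_⟩
  · have hlim' : Tendsto (fun k => (CFC.sqrt (P k)).trace.re • CFC.sqrt (P k)) atTop
        (𝓝 ((CFC.sqrt (Mᴴ * δ * M)).trace.re • CFC.sqrt (Mᴴ * δ * M))) := by
      have hc : Continuous fun W : Matrix E E ℂ => W.trace.re • W :=
        (Complex.continuous_re.comp continuous_id.matrix_trace).smul continuous_id
      exact (hc.tendsto _).comp hlim
    refine le_of_tendsto_matrix hlim' fun k => ?_
    have hpd := posDef_sqrt (hP k)
    -- The first-order condition at the basis state i is exactly the scalar form of the bound on row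
    -- i.
    have h1 := hopt k _ ⟨_, single_mem_incoherentStates i, rfl⟩
    have h2 := (vecMulVec_star_le_smul_iff hpd (trace_re_pos_of_posDef hpd) (star (M i))).mpr (by
      refine le_trans (le_of_eq ?_) h1
      rw [star_star, ← Matrix.mul_assoc, trace_mul_comm, ← Matrix.mul_assoc, ← Matrix.mul_assoc,
        trace_mul_single]
      rw [Matrix.mul_assoc]
      simp [Matrix.mul_apply, dotProduct, mulVec])
    rwa [star_star] at h2
  · rw [trace_smul, Complex.smul_re, smul_eq_mul, sq]

lemma isDiag_inv {X : Matrix A A ℂ} (hX : X.IsDiag) : X⁻¹.IsDiag := by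
  rw [← hX.diagonal_diag, inv_diagonal]
  exact isDiag_diagonal _

/-- Pairing with a diagonal matrix sees only the diagonal, so the dephasing can be removed under the
trace. -/
lemma trace_mul_diagonal_diag {X : Matrix A A ℂ} (hX : X.IsDiag) (Z : Matrix A A ℂ) :
    (X * diagonal Z.diag).trace = (X * Z).trace := by
  rw [← hX.diagonal_diag]
  simp [trace, diagonal_mul]

omit [Fintype A] in
lemma posSemidef_diagonal_diag {Z : Matrix A A ℂ} (hZ : Z.PosSemidef) :
    (diagonal Z.diag).PosSemidef :=
  PosSemidef.diagonal fun _ => hZ.diag_nonneg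

/-- Weak duality: `(∑ i, √⟨v i, σ v i⟩)²`, where `v i` are the rows of `M`, is at most the trace of
any diagonal matrix that bounds `M Mᴴ`. -/
lemma sq_trace_sqrt_diagonal_le (M : Matrix A E ℂ) {σ : Matrix E E ℂ} (hσ : σ ∈ states E)
    {D : Matrix A A ℂ} (hDd : D.IsDiag) (h : M * Mᴴ ≤ D) :
    (CFC.sqrt (diagonal (M * σ * Mᴴ).diag)).trace.re ^ 2 ≤ D.trace.re := by
  have hD : D.PosSemidef := ((posSemidef_self_mul_conjTranspose M).nonneg.trans h).posSemidef
  refine sq_trace_sqrt_le (posSemidef_diagonal_diag (hσ.1.mul_mul_conjTranspose_same M)) hD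
    fun η hη => ?_
  have hX := posDef_add_smul_one hD hη
  have hXd : (D + η • (1 : Matrix A A ℂ)).IsDiag := hDd.add (isDiag_one.smul η)
  set X := D + η • (1 : Matrix A A ℂ)
  have hDX : D ≤ X := by
    rw [le_iff, add_sub_cancel_left]
    exact (PosDef.one.smul hη).posSemidef
  have h1 : M * Mᴴ ≤ (1 : ℝ) • X := by rw [one_smul]; exact h.trans hDX
  -- M Mᴴ ≤ X becomes Mᴴ X⁻¹ M ≤ 1, which can be traced against σ.
  have h2 := (mul_conjTranspose_le_smul_iff hX one_pos M).mp h1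
  have h3 := trace_mul_re_le h2 hσ.1
  rw [trace_mul_diagonal_diag (isDiag_inv hXd), ← Matrix.mul_assoc, trace_mul_comm,
    ← Matrix.mul_assoc, ← Matrix.mul_assoc]
  simpa [hσ.2] using h3

/-- Strong duality for `∑ i, √⟨v i, σ v i⟩`, where `v i` are the rows of `M`, maximised over
states `σ`. -/
lemma exists_state_trace_sqrt_eq [Nonempty A] [Nonempty E] (M : Matrix A E ℂ) :
    ∃ σ ∈ states E, ∃ D : Matrix A A ℂ, D.IsDiag ∧ M * Mᴴ ≤ D ∧
      D.trace.re = (CFC.sqrt (diagonal (M * σ * Mᴴ).diag)).trace.re ^ 2 := by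
  have hcont : Continuous fun σ : Matrix E E ℂ => diagonal (M * σ * Mᴴ).diag := by fun_prop
  have hlin : IsLinearMap ℝ fun σ : Matrix E E ℂ => diagonal (M * σ * Mᴴ).diag :=
    ⟨fun x y => by rw [Matrix.mul_add, Matrix.add_mul, diag_add]; exact (diagonal_add _ _).symm,
      fun c x => by rw [Matrix.mul_smul, Matrix.smul_mul, diag_smul, diagonal_smul]⟩
  obtain ⟨e₀⟩ := ‹Nonempty E›
  obtain ⟨T, ⟨σ, hσ, rfl⟩, P, hP, hPT, hlim, hopt⟩ := exists_tendsto_sqrt_optimal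
    (isCompact_states.image hcont) (convex_states.is_linear_image hlin)
    ⟨_, _, (single_mem_incoherentStates e₀).1, rfl⟩
    (by rintro _ ⟨σ, hσ, rfl⟩
        exact posSemidef_diagonal_diag (hσ.1.mul_mul_conjTranspose_same M))
  have hT := posSemidef_diagonal_diag (hσ.1.mul_mul_conjTranspose_same M)
  refine ⟨σ, hσ, (CFC.sqrt (diagonal (M * σ * Mᴴ).diag)).trace.re •
    CFC.sqrt (diagonal (M * σ * Mᴴ).diag), (isDiag_sqrt hT (isDiag_diagonal _)).smul _, ?_, ?_⟩
  · have hlim' : Tendsto (fun k => (CFC.sqrt (P k)).trace.re • CFC.sqrt (P k)) atTop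
        (𝓝 ((CFC.sqrt (diagonal (M * σ * Mᴴ).diag)).trace.re •
          CFC.sqrt (diagonal (M * σ * Mᴴ).diag))) := by
      have hc : Continuous fun W : Matrix A A ℂ => W.trace.re • W :=
        (Complex.continuous_re.comp continuous_id.matrix_trace).smul continuous_id
      exact (hc.tendsto _).comp hlim
    refine le_of_tendsto_matrix hlim' fun k => ?_
    have hpd := posDef_sqrt (hP k)
    -- The explicit form of `P k` as an element of the set plus ε 1 is what makes it diagonal.
    have hPd : (P k).IsDiag := by
      obtain ⟨_, ⟨τ, -, rfl⟩, ε, h⟩ := hPT k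
      rw [h]
      exact (isDiag_diagonal _).add (isDiag_one.smul ε)
    have hRd := isDiag_sqrt (hP k).posSemidef hPd
    rw [mul_conjTranspose_le_smul_iff hpd (trace_re_pos_of_posDef hpd)]
    have : Nonempty E := ⟨e₀⟩
    refine le_smul_one_of_trace_mul_le
      (hpd.inv.posSemidef.conjTranspose_mul_mul_same M).isHermitian fun τ hτ => ?_
    have h1 := hopt k _ ⟨τ, hτ, rfl⟩
    rw [trace_mul_diagonal_diag (isDiag_inv hRd), ← Matrix.mul_assoc, trace_mul_comm,
      ← Matrix.mul_assoc, ← Matrix.mul_assoc] at h1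
    exact h1
  · rw [trace_smul, Complex.smul_re, smul_eq_mul, sq]

end Duality

/-! ### Logarithms, and the entropies as optimal values of the dual pairs -/

lemma log₂_of_pos {x : ℝ} (hx : 0 < x) : log₂ x = ((Real.logb 2 x : ℝ) : EReal) :=
  if_neg hx.ne'

lemma log₂_le_log₂ {x y : ℝ} (hx : 0 ≤ x) (hxy : x ≤ y) : log₂ x ≤ log₂ y := by
  rcases hx.eq_or_lt with rfl | h
  · simp [log₂]
  · rw [log₂_of_pos h, log₂_of_pos (h.trans_le hxy), EReal.coe_le_coe_iff]
    exact Real.logb_le_logb_of_le one_lt_two h hxy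

section Entropies

variable {A E : Type*} [Fintype A] [DecidableEq A] [Fintype E] [DecidableEq E]

omit [Fintype A] [DecidableEq A] [DecidableEq E] in
lemma partialTrace_ketBra (M : Matrix A E ℂ) :
    partialTrace (ketBra fun x => M x.1 x.2) = M * Mᴴ := by
  ext i j
  simp [partialTrace, ketBra, vecMulVec_apply, Matrix.mul_apply]

lemma dephase_ketBra (M : Matrix A E ℂ) :
    dephase (ketBra fun x => M x.1 x.2) =
      ∑ i, single i i (1 : ℂ) ⊗ₖ vecMulVec (M i) (star (M i)) := by
  refine Finset.sum_congr rfl fun i _ => ?_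
  ext ⟨a, e⟩ ⟨b, f⟩
  simp only [Matrix.mul_apply, kroneckerMap_apply, Fintype.sum_prod_type, ketBra, vecMulVec_apply,
    single_apply, one_apply, Pi.star_apply]
  by_cases ha : i = a <;> by_cases hb : i = b <;> simp [ha, hb] <;> simp_all

lemma dephase_ketBra_apply (M : Matrix A E ℂ) (a b : A) (e f : E) :
    dephase (ketBra fun x => M x.1 x.2) (a, e) (b, f) =
      if a = b then M a e * star (M a f) else 0 := by
  rw [dephase_ketBra, Matrix.sum_apply]
  simp only [kroneckerMap_apply, single_apply, vecMulVec_apply, Pi.star_apply]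
  split_ifs with h
  · subst h; simp
  · refine Finset.sum_eq_zero fun i _ => ?_
    rw [if_neg (by rintro ⟨rfl, rfl⟩; exact h rfl), zero_mul]

/-- Placing row i of `M` as a column in block i gives a factor N of the dephased state for which Nᴴ
(1 ⊗ σ) N is diagonal. The rows enter unconjugated on the right of σ, hence the transpose. -/
lemma fidelity_one_kronecker_dephase (M : Matrix A E ℂ) {σ : Matrix E E ℂ} (hσ : σ.PosSemidef) :
    fidelity ((1 : Matrix A A ℂ) ⊗ₖ σ) (dephase (ketBra fun x => M x.1 x.2)) =
      (CFC.sqrt (diagonal (M * σᵀ * Mᴴ).diag)).trace.re ^ 2 := by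
  let N : Matrix (A × E) A ℂ := of fun x i => if x.1 = i then M x.1 x.2 else 0
  have hN : N * Nᴴ = dephase (ketBra fun x => M x.1 x.2) := by
    ext ⟨a, e⟩ ⟨b, f⟩
    rw [dephase_ketBra_apply]
    by_cases h : a = b
    · subst h; simp [N, Matrix.mul_apply]
    · simp [N, Matrix.mul_apply, h, Ne.symm h]
  have hN' : Nᴴ * ((1 : Matrix A A ℂ) ⊗ₖ σ) * N = diagonal (M * σᵀ * Mᴴ).diag := by
    ext i j
    by_cases h : i = j
    · subst h
      simp only [N, Matrix.mul_apply, conjTranspose_apply, of_apply, kroneckerMap_apply, one_apply,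
        Fintype.sum_prod_type, diagonal_apply_eq, diag_apply, transpose_apply, Finset.sum_mul]
      simp only [apply_ite star, star_zero, ite_mul, mul_ite, zero_mul, mul_zero, one_mul,
        Finset.sum_ite_irrel, Finset.sum_const_zero, Finset.sum_ite_eq',
        Finset.mem_univ, if_true]
      rw [Finset.sum_comm]
      refine Finset.sum_congr rfl fun e _ => Finset.sum_congr rfl fun f _ => by ring
    · simp only [N, Matrix.mul_apply, conjTranspose_apply, of_apply, kroneckerMap_apply, one_apply,
        Fintype.sum_prod_type, diagonal_apply_ne _ h, Finset.sum_mul]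
      simp only [apply_ite star, star_zero, ite_mul, mul_ite, zero_mul, mul_zero, one_mul,
        Finset.sum_ite_irrel, Finset.sum_const_zero, Finset.sum_ite_eq',
        Finset.mem_univ, if_true, Ne.symm h, if_false]
  rw [← hN, fidelity_eq_of_mul_conjTranspose (PosSemidef.one.kronecker hσ), hN']

/-- Both sides are block diagonal, so the inequality splits into one condition per block;
transposing moves the conjugation to the other factor. -/
lemma dephase_ketBra_le_iff (M : Matrix A E ℂ) (S : Matrix E E ℂ) :
    dephase (ketBra fun x => M x.1 x.2) ≤ (1 : Matrix A A ℂ) ⊗ₖ S ↔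
      ∀ i, vecMulVec (star (M i)) (M i) ≤ Sᵀ := by
  have ht : ∀ i, (vecMulVec (star (M i)) (M i) ≤ Sᵀ ↔ vecMulVec (M i) (star (M i)) ≤ S) := by
    intro i
    rw [le_iff, le_iff, ← posSemidef_transpose_iff (M := S - _), transpose_sub,
      transpose_vecMulVec]
  simp only [ht]
  constructor
  · intro h i
    have h' := (le_iff.mp h).submatrix fun e : E => (i, e)
    rw [le_iff]
    convert h' using 1
    ext e f
    simp [dephase_ketBra_apply, vecMulVec_apply]
  · intro h
    have e : (1 : Matrix A A ℂ) ⊗ₖ S - dephase (ketBra fun x => M x.1 x.2) =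
        ∑ i, single i i (1 : ℂ) ⊗ₖ (S - vecMulVec (M i) (star (M i))) := by
      ext ⟨a, e⟩ ⟨b, f⟩
      rw [Matrix.sub_apply, dephase_ketBra_apply, Matrix.sum_apply]
      simp only [kroneckerMap_apply, single_apply, one_apply, Matrix.sub_apply, vecMulVec_apply,
        Pi.star_apply]
      split_ifs with hab
      · subst hab; simp
      · symm
        rw [zero_mul, sub_zero]
        refine Finset.sum_eq_zero fun i _ => ?_
        rw [if_neg (by rintro ⟨rfl, rfl⟩; exact hab rfl), zero_mul]
    rw [le_iff, e]
    exact posSemidef_sum _ fun i _ =>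
      (single_mem_incoherentStates i).1.1.kronecker (le_iff.mp (h i))

omit [DecidableEq E] in
lemma transpose_mem_states {σ : Matrix E E ℂ} (h : σ ∈ states E) : σᵀ ∈ states E :=
  ⟨h.1.transpose, by rw [trace_transpose, h.2]⟩

omit [DecidableEq E] in
lemma trace_eq_ofReal {P : Matrix E E ℂ} (hP : P.PosSemidef) : P.trace = (P.trace.re : ℂ) :=
  Complex.ext rfl (Complex.nonneg_iff.mp hP.trace_nonneg).2.symm

omit [DecidableEq E] in
lemma inv_smul_mem_states {P : Matrix E E ℂ} (hP : P.PosSemidef) (h : 0 < P.trace.re) :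
    P.trace.re⁻¹ • P ∈ states E := by
  refine ⟨hP.smul (inv_nonneg.mpr h.le), ?_⟩
  rw [trace_smul, trace_eq_ofReal hP, Complex.ofReal_re, Complex.real_smul, ← Complex.ofReal_mul,
    inv_mul_cancel₀ h.ne', Complex.ofReal_one]

lemma fidelity_mul_conjTranspose_self (M : Matrix A E ℂ) {δ : Matrix A A ℂ} (hδ : δ.PosSemidef) :
    fidelity (M * Mᴴ) δ = (CFC.sqrt (Mᴴ * δ * M)).trace.re ^ 2 := by
  rw [fidelity_comm (posSemidef_self_mul_conjTranspose M) hδ, fidelity_eq_of_mul_conjTranspose hδ]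

lemma fidelity_nonneg (ρ σ : Matrix A A ℂ) : 0 ≤ fidelity ρ σ := sq_nonneg _

omit [DecidableEq A] in
lemma nonempty_of_mem_states {P : Matrix A A ℂ} (hP : P ∈ states A) : Nonempty A := by
  by_contra h
  rw [not_nonempty_iff] at h
  simpa [trace] using hP.2

omit [DecidableEq A] [DecidableEq E] in
lemma nonempty_of_mul_conjTranspose_mem_states {M : Matrix A E ℂ} (hM : M * Mᴴ ∈ states A) :
    Nonempty E := by
  by_contra h
  rw [not_nonempty_iff] at h
  have := hM.2
  simp [trace, Matrix.mul_apply] at this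

/-- The maximal fidelity with an incoherent state is the exponential of the conditional
min-entropy. -/
lemma exists_max_fidelity_incoherent (M : Matrix A E ℂ) (hM : M * Mᴴ ∈ states A) :
    ∃ m : ℝ, 0 < m ∧
      (∃ δ ∈ incoherentStates A, fidelity (M * Mᴴ) δ = m) ∧
      (∀ δ ∈ incoherentStates A, fidelity (M * Mᴴ) δ ≤ m) ∧
      IsGreatest (hMinSet (dephase (ketBra fun x => M x.1 x.2))) (-Real.logb 2 m) := by
  have := nonempty_of_mem_states hM
  have := nonempty_of_mul_conjTranspose_mem_states hM
  obtain ⟨δ, hδ, S, hS, hle, htr⟩ := exists_incoherent_trace_sqrt_eq M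
  have hpos : 0 < S.trace.re := by
    -- A dual optimum of trace zero would make every row of `M` vanish, against Tr M Mᴴ = 1.
    refine (trace_re_nonneg hS).lt_of_ne fun h0 => ?_
    have hM0 : M = 0 := by
      ext i e
      have h1 := trace_re_mono (hle i)
      rw [← h0, trace_vecMulVec] at h1
      have h2 : (0 : ℂ) ≤ star (M i) ⬝ᵥ M i := dotProduct_star_self_nonneg (M i)
      obtain ⟨h3, h4⟩ := Complex.nonneg_iff.mp h2
      have h5 : star (M i) ⬝ᵥ M i = 0 := Complex.ext (le_antisymm h1 h3) h4.symm
      simpa using congrFun (dotProduct_star_self_eq_zero.mp h5) e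
    have := hM.2
    simp [hM0] at this
  refine ⟨S.trace.re, hpos, ⟨δ, hδ, ?_⟩, fun δ' hδ' => ?_, ?_, ?_⟩
  · rw [fidelity_mul_conjTranspose_self M hδ.1.1, htr]
  · rw [fidelity_mul_conjTranspose_self M hδ'.1.1]
    exact sq_trace_sqrt_conjugate_le M hδ' hS hle
  · refine ⟨(S.trace.re⁻¹ • S)ᵀ, transpose_mem_states (inv_smul_mem_states hS hpos), ?_⟩
    rw [neg_neg, Real.rpow_logb two_pos (by norm_num) hpos, ← kronecker_smul,
      dephase_ketBra_le_iff, ← transpose_smul, transpose_transpose, smul_smul,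
      mul_inv_cancel₀ hpos.ne', one_smul]
    exact hle
  · rintro l ⟨σ, hσ, h⟩
    -- The transpose of 2^(-l) σ is dual feasible with trace 2^(-l), so weak duality bounds l.
    have h2 : (0 : ℝ) < 2 ^ (-l) := by positivity
    rw [← kronecker_smul, dephase_ketBra_le_iff] at h
    have h3 := sq_trace_sqrt_conjugate_le M hδ (hσ.1.smul h2.le).transpose h
    rw [← htr, trace_transpose, trace_smul, hσ.2] at h3
    have h4 : S.trace.re ≤ 2 ^ (-l) := by simpa using h3
    have h5 := Real.logb_le_logb_of_le one_lt_two hpos h4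
    rw [Real.logb_rpow two_pos (by norm_num)] at h5
    linarith

omit [DecidableEq A] [DecidableEq E] in
lemma posSemidef_of_mul_conjTranspose_le {D : Matrix A A ℂ} {M : Matrix A E ℂ} (h : M * Mᴴ ≤ D) :
    D.PosSemidef :=
  ((posSemidef_self_mul_conjTranspose M).nonneg.trans h).posSemidef

/-- The minimal max-divergence from an incoherent state is the conditional max-entropy. -/
lemma exists_min_dMax_incoherent (M : Matrix A E ℂ) (hM : M * Mᴴ ∈ states A) :
    ∃ r : ℝ, IsLeast ((fun δ => dMax (M * Mᴴ) δ) '' incoherentStates A) (r : EReal) ∧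
      IsGreatest (hMaxSet (dephase (ketBra fun x => M x.1 x.2))) (r : EReal) := by
  have := nonempty_of_mem_states hM
  have := nonempty_of_mul_conjTranspose_mem_states hM
  obtain ⟨σ, hσ, D, hDd, hle, htr⟩ := exists_state_trace_sqrt_eq M
  have hD := posSemidef_of_mul_conjTranspose_le hle
  have hpos : 0 < D.trace.re := by
    have h1 := trace_re_mono hle
    rw [hM.2, Complex.one_re] at h1
    linarith
  -- l δ is diagonal of trace l, hence dual feasible. This gives both the value of `dMax` at the
  -- normalised `D` and its minimality.
  have hweak : ∀ δ ∈ incoherentStates A, ∀ l : ℝ, M * Mᴴ ≤ l • δ → D.trace.re ≤ l := by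
    intro δ hδ l h
    have h3 := sq_trace_sqrt_diagonal_le M hσ (hδ.2.smul l) h
    rw [← htr, trace_smul, hδ.1.2] at h3
    simpa using h3
  refine ⟨Real.logb 2 D.trace.re, ⟨⟨D.trace.re⁻¹ • D,
    ⟨inv_smul_mem_states hD hpos, hDd.smul _⟩, ?_⟩, ?_⟩, ⟨σᵀ, transpose_mem_states hσ, ?_⟩, ?_⟩
  · have hmem : D.trace.re ∈ {l : ℝ | M * Mᴴ ≤ l • (D.trace.re⁻¹ • D)} := by
      rw [Set.mem_ofPred_eq, smul_smul, mul_inv_cancel₀ hpos.ne', one_smul]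
      exact hle
    have hleast : IsLeast {l : ℝ | M * Mᴴ ≤ l • (D.trace.re⁻¹ • D)} D.trace.re :=
      ⟨hmem, fun l hl => hweak _ ⟨inv_smul_mem_states hD hpos, hDd.smul _⟩ l hl⟩
    simp only [dMax]
    rw [if_pos ⟨_, hmem⟩, hleast.csInf_eq, log₂_of_pos hpos]
  · rintro _ ⟨δ, hδ, rfl⟩
    simp only [dMax]
    split_ifs with hne
    · rw [← log₂_of_pos hpos]
      exact log₂_le_log₂ hpos.le (le_csInf hne fun l hl => hweak δ hδ l hl)
    · exact le_top
  · simp only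
    rw [fidelity_one_kronecker_dephase M hσ.1.transpose, transpose_transpose, ← htr,
      log₂_of_pos hpos]
  · rintro _ ⟨τ, hτ, rfl⟩
    simp only
    rw [← log₂_of_pos hpos]
    refine log₂_le_log₂ (fidelity_nonneg _ _) ?_
    rw [fidelity_one_kronecker_dephase M hτ.1]
    exact sq_trace_sqrt_diagonal_le M (transpose_mem_states hτ) hDd hle

end Entropies

end CoherenceEntropy

/-! ### The theorem -/

theorem theorem3 {A E : Type*} [Fintype A] [DecidableEq A] [Fintype E] [DecidableEq E]
    (ρ : Matrix A A ℂ) (hρ : ρ ∈ states A)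
    (ψ : A × E → ℂ) (hψ : partialTrace (ketBra ψ) = ρ) :
    -- the three identities
    (cMax ρ = hMax (dephase (ketBra ψ)) ∧
      cMin ρ = ((hMin (dephase (ketBra ψ)) : ℝ) : EReal) ∧
      cGeom ρ = 1 - (2 : ℝ) ^ (-hMin (dephase (ketBra ψ)))) ∧
    -- the common value in the first one is a real number
    (∃ r : ℝ, cMax ρ = (r : EReal)) ∧
    -- all the minima and maxima in the definitions are attained
    IsLeast ((fun δ => dMax ρ δ) '' incoherentStates A) (cMax ρ) ∧
    IsLeast ((fun δ => dMin ρ δ) '' incoherentStates A) (cMin ρ) ∧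
    IsLeast ((fun δ => 1 - fidelity ρ δ) '' incoherentStates A) (cGeom ρ) ∧
    IsGreatest (hMaxSet (dephase (ketBra ψ))) (hMax (dephase (ketBra ψ))) ∧
    IsGreatest (hMinSet (dephase (ketBra ψ))) (hMin (dephase (ketBra ψ))) := by
  obtain ⟨M, rfl⟩ : ∃ M : Matrix A E ℂ, ψ = fun x => M x.1 x.2 :=
    ⟨Matrix.of fun i e => ψ (i, e), rfl⟩
  rw [partialTrace_ketBra] at hψ
  subst hψ
  obtain ⟨m, hm, ⟨δ, hδ, hδm⟩, hle, hGreatest⟩ := exists_max_fidelity_incoherent M hρ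
  obtain ⟨r, hleast, hgreatest⟩ := exists_min_dMax_incoherent M hρ
  have hcMax : cMax (M * M.conjTranspose) = r := hleast.csInf_eq
  have hhMax : hMax (dephase (ketBra fun x => M x.1 x.2)) = r := hgreatest.csSup_eq
  have hhMin : hMin (dephase (ketBra fun x => M x.1 x.2)) = -Real.logb 2 m := hGreatest.csSup_eq
  have hleastMin : IsLeast ((fun δ => dMin (M * M.conjTranspose) δ) '' incoherentStates A)
      ((-Real.logb 2 m : ℝ) : EReal) := by
    refine ⟨⟨δ, hδ, ?_⟩, ?_⟩
    · simp only [dMin]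
      rw [hδm, log₂_of_pos hm, EReal.coe_neg]
    · rintro _ ⟨δ', hδ', rfl⟩
      rw [EReal.coe_neg, ← log₂_of_pos hm]
      exact EReal.neg_le_neg_iff.mpr (log₂_le_log₂ (fidelity_nonneg _ _) (hle δ' hδ'))
  have hcMin : cMin (M * M.conjTranspose) = ((-Real.logb 2 m : ℝ) : EReal) := hleastMin.csInf_eq
  have hleastGeom : IsLeast ((fun δ => 1 - fidelity (M * M.conjTranspose) δ) ''
      incoherentStates A) (1 - m) := by
    refine ⟨⟨δ, hδ, by simp only [hδm]⟩, ?_⟩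
    rintro _ ⟨δ', hδ', rfl⟩
    exact sub_le_sub_left (hle δ' hδ') 1
  have hcGeom : cGeom (M * M.conjTranspose) = 1 - m := hleastGeom.csInf_eq
  refine ⟨⟨hcMax.trans hhMax.symm, by rw [hcMin, hhMin], ?_⟩, ⟨r, hcMax⟩, hcMax ▸ hleast,
    hcMin ▸ hleastMin, hcGeom ▸ hleastGeom, hhMax ▸ hgreatest, hhMin ▸ hGreatest⟩
  rw [hcGeom, hhMin, neg_neg, Real.rpow_logb two_pos (by norm_num) hm]
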